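/- All graphs are finite, simple and undirected. A graph $G$ is $K_{1,k}$-free if it has no induced subgraph isomorphic to the star $K_{1,k}$. A (not necessarily proper) coloring $c : V(G) \to \{1,\dots,r\}$ is a conflict-free closed-neighborhood (CFCN) coloring if for every vertex $v$ some color appears exactly once in the closed neighborhood $N_G(v) \cup \{v\}$; $\chi_{CF}^{CN}(G)$ denotes the least $r$ for which $G$ has such a coloring. **Corollary 3.** There is an absolute constant $C > 0$ such that for every non-negative integer $k$ and every $K_{1,k}$-free graph $G$ (possibly with isolated vertices) of maximum degree $\Delta \ge 2$, $$\chi_{CF}^{CN}(G) \le C\, k^2 \ln \Delta .$$ That is, $\chi_{CF}^{CN}(G) = O(k^2 \ln \Delta)$. -/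

import Mathlib

namespace SimpleGraph

/-- `G` is `K_{1,k}`-free: it has no induced subgraph isomorphic to the star `K_{1,k}`. -/
def IsStarFree {V : Type*} (G : SimpleGraph V) (k : ℕ) : Prop :=
  ¬ (completeBipartiteGraph (Fin 1) (Fin k)).IsIndContained G

/-- The closed neighborhood `N_G(v) ∪ {v}`. -/
def closedNeighborSet {V : Type*} (G : SimpleGraph V) (v : V) : Set V :=
  insert v (G.neighborSet v)

/-- A (not necessarily proper) vertex coloring such that every vertex has some color that appears
exactly once in its closed neighborhood. -/
def IsCFCNColoring {V α : Type*} (G : SimpleGraph V) (c : V → α) : Prop :=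
  ∀ v : V, ∃ a : α, ∃! u : V, u ∈ G.closedNeighborSet v ∧ c u = a

/-- The least `r` such that some `c : V → [r]` is a conflict-free closed neighborhood coloring. -/
noncomputable def cfcnChromaticNumber {V : Type*} (G : SimpleGraph V) : ℕ :=
  sInf {r : ℕ | ∃ c : V → Fin r, G.IsCFCNColoring c}

/-- On a finite graph the minimum is over a nonempty set, so it is attained. -/
theorem exists_isCFCNColoring_cfcnChromaticNumber {V : Type*} [Finite V] (G : SimpleGraph V) :
    ∃ c : V → Fin G.cfcnChromaticNumber, G.IsCFCNColoring c := by
  have h : {r : ℕ | ∃ c : V → Fin r, G.IsCFCNColoring c}.Nonempty :=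
    ⟨Nat.card V, Finite.equivFin V, fun v => ⟨Finite.equivFin V v, v,
      ⟨Set.mem_insert v _, rfl⟩, fun _ hu => (Finite.equivFin V).injective hu.2⟩⟩
  exact Nat.sInf_mem h

end SimpleGraph

/-! Let `A` be a maximal vertex set inducing a `2L`-colorable subgraph, with `2 ^ L ≥ 4Δ`. By
maximality each `w ∉ A` has a neighbor in every color class, so at least `2L` neighbors in `A`;
classes are independent, so star-freeness leaves every vertex at most `2kL` neighbors in `A`.

It suffices to color `A` properly with `24kL` colors so that each trace `N(w) ∩ A`, `w ∉ A`, has a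
uniquely occurring color, and to give all other vertices one extra color: a vertex of `A` is then
served by its own color, any other by its trace.

Such a coloring comes from counting in place of the local lemma (`exists_isGoodOn`). Colorings of
all of `V` are counted, so counts for different `S` compare like probabilities. Adding `v` to `S` at
most halves the count: clashes with neighbors lose at most a quarter, and so do the at most `Δ`
traces through `v`. -/

namespace SimpleGraph

open Finset

/-! ### Counting colorings: independence and conflict probability -/

section Counting

variable {V ι : Type*} {R : ℕ}

/-- Some value of `f` is taken exactly once on `E`. -/
def HasUniqueColor {α : Type*} (f : V → α) (E : Finset V) : Prop :=
  ∃ u ∈ E, ∀ w ∈ E, f w = f u → w = u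

/-- `f` is proper on `S` and conflict-free on those edges `E i`, `i ∈ W`, that lie inside `S`. -/
def IsGoodOn (G : SimpleGraph V) (W : Finset ι) (E : ι → Finset V) (S : Finset V)
    (f : V → Fin R) : Prop :=
  (∀ u ∈ S, ∀ w ∈ S, G.Adj u w → f u ≠ f w) ∧ ∀ i ∈ W, E i ⊆ S → HasUniqueColor f (E i)

theorem HasUniqueColor.congr {α : Type*} {f g : V → α} {E : Finset V}
    (h : ∀ u ∈ E, f u = g u) (hf : HasUniqueColor f E) : HasUniqueColor g E := by
  obtain ⟨u, hu, hu'⟩ := hf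
  refine ⟨u, hu, fun w hw hwu => hu' w hw ?_⟩
  rw [h w hw, h u hu, hwu]

theorem IsGoodOn.congr {G : SimpleGraph V} {W : Finset ι} {E : ι → Finset V} {S : Finset V}
    {f g : V → Fin R} (h : ∀ u ∈ S, f u = g u) (hf : G.IsGoodOn W E S f) :
    G.IsGoodOn W E S g := by
  refine ⟨fun u hu w hw huw => ?_, fun i hi hS => (hf.2 i hi hS).congr fun u hu => h u (hS hu)⟩
  rw [← h u hu, ← h w hw]
  exact hf.1 u hu w hw huw

theorem IsGoodOn.mono {G : SimpleGraph V} {W : Finset ι} {E : ι → Finset V} {S T : Finset V}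
    {f : V → Fin R} (hTS : T ⊆ S) (hf : G.IsGoodOn W E S f) : G.IsGoodOn W E T f :=
  ⟨fun u hu w hw => hf.1 u (hTS hu) w (hTS hw), fun i hi hT => hf.2 i hi (hT.trans hTS)⟩

/-- Each color used on `E` occurs at least twice, so at most half of `#E` colors occur. Padding the
palette to an exact size makes the later union bound uniform. -/
theorem exists_card_eq_and_mapsTo {f : V → Fin R} {E : Finset V} (h : ¬ HasUniqueColor f E)
    (hR : #E / 2 ≤ R) : ∃ T : Finset (Fin R), #T = #E / 2 ∧ ∀ u ∈ E, f u ∈ T := by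
  classical
  have h2 : 2 * #(E.image f) ≤ #E := by
    refine mul_card_image_le_card E 2 fun b hb => ?_
    obtain ⟨u, hu, rfl⟩ := mem_image.1 hb
    by_contra! hlt
    refine h ⟨u, hu, fun w hw hwu => ?_⟩
    exact card_le_one.1 (Nat.le_of_lt_succ hlt) w (by simp [hw, hwu]) u (by simp [hu])
  obtain ⟨T, hT, hTc⟩ := exists_superset_card_eq (s := E.image f) (n := #E / 2)
    (by omega) (by simpa using hR)
  exact ⟨T, hTc, fun u hu => hT (mem_image_of_mem f hu)⟩

variable [Fintype V]

open Classical in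
/-- Events depending on disjoint sets of coordinates are independent under the uniform measure
on colorings. -/
theorem card_filter_and_mul (E : Finset V) (p q : (V → Fin R) → Prop)
    [DecidablePred p] [DecidablePred q]
    (hp : ∀ f g, (∀ u ∉ E, f u = g u) → p f → p g)
    (hq : ∀ f g, (∀ u ∈ E, f u = g u) → q f → q g) :
    #{f | p f ∧ q f} * R ^ Fintype.card V = #{f | p f} * #{f | q f} := by
  have hR : R ^ Fintype.card V = #(univ : Finset (V → Fin R)) := by simp
  rw [hR, ← card_product, ← card_product]
  -- Exchanging two colorings on `E` is an involution; it carries pairs whose first entry satisfies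
  -- both events to pairs satisfying one event each.
  let φ : (V → Fin R) × (V → Fin R) → (V → Fin R) × (V → Fin R) := fun x =>
    (fun u => if u ∈ E then x.2 u else x.1 u, fun u => if u ∈ E then x.1 u else x.2 u)
  have hφ : ∀ x, φ (φ x) = x := by
    rintro ⟨f, g⟩
    ext u <;> simp only [φ] <;> split_ifs <;> rfl
  refine card_bij' (fun x _ => φ x) (fun x _ => φ x) ?_ ?_ (fun x _ => hφ x) (fun x _ => hφ x)
  · rintro ⟨f, g⟩ h
    simp only [mem_product, mem_filter, mem_univ, true_and, and_true] at h ⊢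
    exact ⟨hp f _ (fun u hu => by simp [φ, hu]) h.1, hq f _ (fun u hu => by simp [φ, hu]) h.2⟩
  · rintro ⟨f, g⟩ h
    simp only [mem_product, mem_filter, mem_univ, true_and, and_true] at h ⊢
    exact ⟨hp f _ (fun u hu => by simp [φ, hu]) h.1, hq g _ (fun u hu => by simp [φ, hu]) h.2⟩

open Classical in
theorem card_filter_forall_mem (E : Finset V) (T : Finset (Fin R)) :
    #{f : V → Fin R | ∀ u ∈ E, f u ∈ T} = #T ^ #E * R ^ (Fintype.card V - #E) := by
  have h : ({f : V → Fin R | ∀ u ∈ E, f u ∈ T} : Finset (V → Fin R)) =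
      Fintype.piFinset fun u => if u ∈ E then T else univ := by
    ext f
    simp only [mem_filter, mem_univ, true_and, Fintype.mem_piFinset]
    refine forall_congr' fun u => ?_
    split_ifs with hu <;> simp [hu]
  rw [h, Fintype.card_piFinset]
  simp only [apply_ite Finset.card, prod_ite, prod_const, card_univ, Fintype.card_fin]
  congr 2
  · simp
  · rw [← card_compl]
    congr 1
    ext u
    simp

open Classical in
theorem card_filter_not_hasUniqueColor_le (E : Finset V) (hR : #E / 2 ≤ R) :
    #{f : V → Fin R | ¬ HasUniqueColor f E} ≤
      R.choose (#E / 2) * ((#E / 2) ^ #E * R ^ (Fintype.card V - #E)) := by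
  calc #{f : V → Fin R | ¬ HasUniqueColor f E}
      ≤ #((powersetCard (#E / 2) (univ : Finset (Fin R))).biUnion
          fun T => ({f : V → Fin R | ∀ u ∈ E, f u ∈ T} : Finset (V → Fin R))) := by
        refine card_le_card fun f hf => ?_
        obtain ⟨T, hT, hfT⟩ := exists_card_eq_and_mapsTo (mem_filter.1 hf).2 hR
        simp only [mem_biUnion, mem_powersetCard, mem_filter, mem_univ, true_and]
        exact ⟨T, ⟨subset_univ _, hT⟩, hfT⟩
    _ ≤ #(powersetCard (#E / 2) (univ : Finset (Fin R))) *
          ((#E / 2) ^ #E * R ^ (Fintype.card V - #E)) := by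
        refine card_biUnion_le_card_mul _ _ _ fun T hT => ?_
        rw [card_filter_forall_mem, (mem_powersetCard.1 hT).2]
    _ = _ := by simp

theorem pow_self_le_three_pow_mul_factorial (m : ℕ) : m ^ m ≤ 3 ^ m * m.factorial := by
  have h := Real.pow_div_factorial_le_exp (m : ℝ) (Nat.cast_nonneg m) m
  rw [div_le_iff₀ (by positivity)] at h
  have h3 : Real.exp m ≤ 3 ^ m := by
    rw [← mul_one (m : ℝ), Real.exp_nat_mul]
    exact pow_le_pow_left₀ (Real.exp_pos 1).le Real.exp_one_lt_three.le m
  exact_mod_cast h.trans (mul_le_mul_of_nonneg_right h3 (by positivity))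

theorem choose_mul_pow_le (R m : ℕ) : R.choose m * m ^ m ≤ 3 ^ m * R ^ m := by
  calc R.choose m * m ^ m ≤ R.choose m * (3 ^ m * m.factorial) :=
        Nat.mul_le_mul_left _ (pow_self_le_three_pow_mul_factorial m)
    _ = 3 ^ m * (m.factorial * R.choose m) := by ring
    _ ≤ 3 ^ m * R ^ m := by
        rw [← Nat.descFactorial_eq_factorial_mul_choose]
        exact Nat.mul_le_mul_left _ (Nat.descFactorial_le_pow R m)

/-- With `m = n / 2`, the factors `2 ^ m` bounding `4 * D`, `2 ^ (2 * m)`, and `3 ^ m` from the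
binomial estimate combine to `24 ^ m`, which is absorbed by `24 * m ≤ R`. -/
theorem mul_choose_mul_pow_le {R D n : ℕ} (hR : 24 * (n / 2) ≤ R) (hD : 4 * D ≤ 2 ^ (n / 2)) :
    4 * D * 2 ^ n * (R.choose (n / 2) * (n / 2) ^ n) ≤ R ^ n := by
  obtain ⟨m, e, he, rfl⟩ : ∃ m e, e < 2 ∧ n = 2 * m + e :=
    ⟨n / 2, n % 2, Nat.mod_lt _ two_pos, (Nat.div_add_mod n 2).symm⟩
  have hm : (2 * m + e) / 2 = m := by omega
  rw [hm] at hR hD ⊢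
  calc 4 * D * 2 ^ (2 * m + e) * (R.choose m * m ^ (2 * m + e))
      ≤ 2 ^ m * 2 ^ (2 * m + e) * (R.choose m * m ^ (2 * m + e)) := by gcongr
    _ = 2 ^ m * 2 ^ m * 2 ^ m * m ^ m * (2 * m) ^ e * (R.choose m * m ^ m) := by
        rw [mul_pow]; ring
    _ ≤ 2 ^ m * 2 ^ m * 2 ^ m * m ^ m * (2 * m) ^ e * (3 ^ m * R ^ m) :=
        Nat.mul_le_mul_left _ (choose_mul_pow_le R m)
    _ = (24 * m) ^ m * R ^ m * (2 * m) ^ e := by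
        rw [show 24 * m = 2 * 2 * 2 * 3 * m by ring]; simp only [mul_pow]; ring
    _ ≤ R ^ m * R ^ m * R ^ e := by gcongr; omega
    _ = R ^ (2 * m + e) := by ring

open Classical in
theorem mul_card_filter_not_hasUniqueColor_le {D : ℕ} (E : Finset V) (hR : 24 * (#E / 2) ≤ R)
    (hD : 4 * D ≤ 2 ^ (#E / 2)) :
    4 * D * 2 ^ #E * #{f : V → Fin R | ¬ HasUniqueColor f E} ≤ R ^ Fintype.card V := by
  calc 4 * D * 2 ^ #E * #{f : V → Fin R | ¬ HasUniqueColor f E}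
      ≤ 4 * D * 2 ^ #E *
          (R.choose (#E / 2) * ((#E / 2) ^ #E * R ^ (Fintype.card V - #E))) :=
        Nat.mul_le_mul_left _ (card_filter_not_hasUniqueColor_le E (by omega))
    _ = 4 * D * 2 ^ #E * (R.choose (#E / 2) * (#E / 2) ^ #E) *
          R ^ (Fintype.card V - #E) := by ring
    _ ≤ R ^ #E * R ^ (Fintype.card V - #E) :=
        Nat.mul_le_mul_right _ (mul_choose_mul_pow_le hR hD)
    _ = R ^ Fintype.card V := by
        rw [← pow_add, Nat.add_sub_cancel' (card_le_univ E)]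

/-! ### Inductive counting of good colorings -/

variable (G : SimpleGraph V) (W : Finset ι) (E : ι → Finset V)

open Classical in
/-- The number of colorings of `V` that are good on `S`. -/
noncomputable def goodCount (R : ℕ) (S : Finset V) : ℕ :=
  #{f : V → Fin R | G.IsGoodOn W E S f}

open Classical in
-- Recoloring `v ∉ S` arbitrarily keeps goodness on `S`, and the old color of `v` is recovered from
-- `u`.
theorem mul_card_filter_isGoodOn_and_eq_le {S : Finset V} {u v : V} (hv : v ∉ S) (huv : u ≠ v) :
    R * #{f : V → Fin R | G.IsGoodOn W E S f ∧ f u = f v} ≤ G.goodCount W E R S := by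
  have hR : #(univ : Finset (Fin R)) = R := by simp
  refine (congrArg (· * _) hR).symm.trans_le ?_
  rw [← card_product]
  refine card_le_card_of_injOn (fun x => Function.update x.2 v x.1) ?_ ?_
  · rintro ⟨c, f⟩ h
    simp only [coe_product, coe_univ, coe_filter, mem_univ, true_and, Set.mem_prod, Set.mem_univ,
      Set.mem_ofPred_eq] at h ⊢
    refine h.1.congr fun w hw => ?_
    rw [Function.update_of_ne]
    rintro rfl
    exact hv hw
  · rintro ⟨c, f⟩ h ⟨d, g⟩ h' heq
    simp only [coe_product, coe_univ, coe_filter, mem_univ, true_and, Set.mem_prod, Set.mem_univ,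
      Set.mem_ofPred_eq] at h h' heq
    have hne : ∀ w, w ≠ v → f w = g w := fun w hw => by
      simpa [Function.update_of_ne hw] using congrFun heq w
    have hcd : c = d := by simpa using congrFun heq v
    refine Prod.ext hcd (funext fun w => ?_)
    by_cases hw : w = v
    · change f w = g w
      rw [hw, ← h.2, ← h'.2, hne u huv]
    · exact hne w hw

open Classical in
theorem mul_card_filter_isGoodOn_and_not_le {D : ℕ} {T F : Finset V} (hTF : Disjoint T F)
    (hR : 0 < R) (hF : 24 * (#F / 2) ≤ R) (hD : 4 * D ≤ 2 ^ (#F / 2)) :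
    4 * D * 2 ^ #F * #{f : V → Fin R | G.IsGoodOn W E T f ∧ ¬ HasUniqueColor f F} ≤
      G.goodCount W E R T := by
  have hind := card_filter_and_mul (R := R) F (G.IsGoodOn W E T) (fun f => ¬ HasUniqueColor f F)
    (fun f g h hf => hf.congr fun u hu => h u (Finset.disjoint_left.1 hTF hu))
    (fun f g h hf hg => hf (hg.congr fun u hu => (h u hu).symm))
  refine Nat.le_of_mul_le_mul_right ?_ (pow_pos hR (Fintype.card V))
  calc _ = G.goodCount W E R T *
        (4 * D * 2 ^ #F * #{f : V → Fin R | ¬ HasUniqueColor f F}) := by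
        rw [mul_assoc, hind, goodCount]; ring
    _ ≤ _ := Nat.mul_le_mul_left _ (mul_card_filter_not_hasUniqueColor_le F hF hD)

open Classical in
/-- Requiring one more vertex `v` to be good at most halves the number of good colorings. -/
theorem goodCount_le_two_mul_goodCount_insert [DecidableRel G.Adj] {D : ℕ} {S : Finset V} {v : V}
    (hv : v ∉ S) (hR : 0 < R) (hdeg : 4 * #{u ∈ S | G.Adj v u} ≤ R) (hW : #{i ∈ W | v ∈ E i} ≤ D)
    (hER : ∀ i ∈ W, 24 * (#(E i) / 2) ≤ R) (hED : ∀ i ∈ W, 4 * D ≤ 2 ^ (#(E i) / 2))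
    (ih : ∀ T ⊆ S, G.goodCount W E R T ≤ 2 ^ #(S \ T) * G.goodCount W E R S) :
    G.goodCount W E R S ≤ 2 * G.goodCount W E R (insert v S) := by
  set N := G.goodCount W E R S with hN
  let A : V → Finset (V → Fin R) := fun u => {f | G.IsGoodOn W E S f ∧ f u = f v}
  let B : ι → Finset (V → Fin R) :=
    fun i => {f | G.IsGoodOn W E (S \ E i) f ∧ ¬ HasUniqueColor f (E i)}
  -- A coloring good on `S` but not on `insert v S` fails at an edge of `G` from `v` into `S`, or on
  -- some `E i` containing `v`.
  have hcover : N ≤ G.goodCount W E R (insert v S) + ∑ u ∈ S with G.Adj v u, #(A u) +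
      ∑ i ∈ W with v ∈ E i, #(B i) := by
    refine (card_le_card (t := (({f | G.IsGoodOn W E (insert v S) f} : Finset (V → Fin R)) ∪
      ({u ∈ S | G.Adj v u} : Finset V).biUnion A) ∪
      ({i ∈ W | v ∈ E i} : Finset ι).biUnion B) fun f hf => ?_).trans <|
      (card_union_le _ _).trans <| add_le_add ((card_union_le _ _).trans <|
        add_le_add le_rfl card_biUnion_le) card_biUnion_le
    have hf : G.IsGoodOn W E S f := (mem_filter.1 hf).2
    by_contra hcon
    simp only [mem_union, mem_biUnion, mem_filter, mem_univ, true_and, A, B, not_or, not_exists,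
      not_and, not_not] at hcon
    obtain ⟨⟨h1, h2⟩, h3⟩ := hcon
    refine h1 ⟨fun u hu w hw huw => ?_, fun i hi hiS => ?_⟩
    · rcases mem_insert.1 hu with rfl | huS <;> rcases mem_insert.1 hw with rfl | hwS
      · exact absurd huw (G.loopless.irrefl _)
      · exact fun h => h2 w ⟨hwS, huw⟩ hf h.symm
      · exact fun h => h2 u ⟨huS, huw.symm⟩ hf h
      · exact hf.1 u huS w hwS huw
    · by_cases hvi : v ∈ E i
      · exact h3 i ⟨hi, hvi⟩ (hf.mono sdiff_subset)
      · exact hf.2 i hi fun u hu => (mem_insert.1 (hiS hu)).resolve_left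
          (by rintro rfl; exact hvi hu)
  have hA : 4 * ∑ u ∈ S with G.Adj v u, #(A u) ≤ N := by
    have h1 : R * ∑ u ∈ S with G.Adj v u, #(A u) ≤ #{u ∈ S | G.Adj v u} * N := by
      rw [mul_sum, ← smul_eq_mul (a := #_)]
      refine sum_le_card_nsmul _ _ _ fun u hu => ?_
      exact G.mul_card_filter_isGoodOn_and_eq_le W E hv (mem_filter.1 hu).2.ne'
    refine Nat.le_of_mul_le_mul_left ?_ hR
    calc R * (4 * ∑ u ∈ S with G.Adj v u, #(A u))
        = 4 * (R * ∑ u ∈ S with G.Adj v u, #(A u)) := by ring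
      _ ≤ 4 * (#{u ∈ S | G.Adj v u} * N) := Nat.mul_le_mul_left _ h1
      _ = 4 * #{u ∈ S | G.Adj v u} * N := by ring
      _ ≤ R * N := Nat.mul_le_mul_right _ hdeg
  have hB : 4 * ∑ i ∈ W with v ∈ E i, #(B i) ≤ N := by
    have h1 : ∀ i ∈ ({i ∈ W | v ∈ E i} : Finset ι), 4 * D * #(B i) ≤ N := fun i hi => by
      have hiW := (mem_filter.1 hi).1
      have h2 := G.mul_card_filter_isGoodOn_and_not_le W E (T := S \ E i) (F := E i)
        sdiff_disjoint hR (hER i hiW) (hED i hiW)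
      -- Forgetting `E i` makes goodness independent of the conflict on `E i`; by induction it costs
      -- at most `2 ^ #(E i)`, the factor built into `h2`.
      have h3 : G.goodCount W E R (S \ E i) ≤ 2 ^ #(E i) * N :=
        (ih _ sdiff_subset).trans <| Nat.mul_le_mul_right _ <| Nat.pow_le_pow_right two_pos <|
          card_le_card fun u hu => by
            simp only [mem_sdiff, not_and, not_not] at hu
            exact hu.2 hu.1
      refine Nat.le_of_mul_le_mul_left (h2.trans h3 |>.trans_eq' ?_) (pow_pos two_pos #(E i))
      simp only [B]; ring
    rcases Nat.eq_zero_or_pos D with rfl | hD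
    · rw [card_eq_zero.1 (Nat.le_zero.1 hW)]
      simp
    · refine Nat.le_of_mul_le_mul_left ?_ hD
      calc D * (4 * ∑ i ∈ W with v ∈ E i, #(B i))
          = ∑ i ∈ W with v ∈ E i, 4 * D * #(B i) := by rw [← mul_sum]; ring
        _ ≤ #{i ∈ W | v ∈ E i} * N := by
            rw [← smul_eq_mul (a := #_)]
            exact sum_le_card_nsmul _ _ _ h1
        _ ≤ D * N := Nat.mul_le_mul_right _ hW
  omega

open Classical in
/-- A set `A` of small induced degree has a proper coloring with `R` colors that is conflict-free
on every edge of a family of low degree whose edges are neither too small nor too large. -/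
theorem exists_isGoodOn [DecidableRel G.Adj] {D : ℕ} (A : Finset V) (hR : 0 < R)
    (hdeg : ∀ v, 4 * #{u ∈ A | G.Adj v u} ≤ R) (hW : ∀ v, #{i ∈ W | v ∈ E i} ≤ D)
    (hE : ∀ i ∈ W, (E i).Nonempty)
    (hER : ∀ i ∈ W, 24 * (#(E i) / 2) ≤ R) (hED : ∀ i ∈ W, 4 * D ≤ 2 ^ (#(E i) / 2)) :
    ∃ f : V → Fin R, G.IsGoodOn W E A f := by
  have key : ∀ S ⊆ A, ∀ T ⊆ S,
      G.goodCount W E R T ≤ 2 ^ #(S \ T) * G.goodCount W E R S := by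
    intro S
    induction S using Finset.strongInduction with
    | H S ih =>
      intro hSA T hTS
      rcases hTS.eq_or_ssubset with rfl | hss
      · simp
      obtain ⟨v, hvS, hvT⟩ := exists_of_ssubset hss
      have hsub : S.erase v ⊂ S := erase_ssubset hvS
      have hTv : T ⊆ S.erase v := subset_erase.2 ⟨hTS, hvT⟩
      have ih' := ih _ hsub (hsub.subset.trans hSA)
      have hstep := G.goodCount_le_two_mul_goodCount_insert W E (notMem_erase v S) hR
        ((Nat.mul_le_mul_left 4 <| card_le_card <|
          filter_subset_filter _ (hsub.subset.trans hSA)).trans (hdeg v)) (hW v) hER hED ih'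
      rw [insert_erase hvS] at hstep
      have hcard : #(S \ T) = #(S.erase v \ T) + 1 := by
        rw [erase_sdiff_comm, card_erase_add_one (mem_sdiff.2 ⟨hvS, hvT⟩)]
      calc G.goodCount W E R T ≤ 2 ^ #(S.erase v \ T) * G.goodCount W E R (S.erase v) :=
            ih' T hTv
        _ ≤ 2 ^ #(S.erase v \ T) * (2 * G.goodCount W E R S) := Nat.mul_le_mul_left _ hstep
        _ = 2 ^ #(S \ T) * G.goodCount W E R S := by rw [hcard]; ring
  -- On `∅` every coloring is good, because no edge of the family is empty.
  have h0 : 0 < G.goodCount W E R ∅ := by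
    refine card_pos.2 ⟨fun _ => ⟨0, hR⟩, mem_filter.2 ⟨mem_univ _, by simp, fun i hi h => ?_⟩⟩
    exact absurd (subset_empty.1 h) (hE i hi).ne_empty
  have hA := h0.trans_le (key A subset_rfl ∅ (empty_subset A))
  obtain ⟨f, hf⟩ := card_pos.1 (Nat.pos_of_mul_pos_left hA)
  exact ⟨f, (mem_filter.1 hf).2⟩

end Counting

/-! ### Star-free graphs and the maximal colorable set -/

section StarFree

variable {V : Type*} {G : SimpleGraph V} {k : ℕ}

theorem IsStarFree.card_lt (hG : G.IsStarFree k) (v : V) (s : Finset V)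
    (hs : ∀ u ∈ s, G.Adj v u) (hind : ∀ u ∈ s, ∀ w ∈ s, ¬ G.Adj u w) : #s < k := by
  by_contra! hk
  obtain ⟨t, hts, htk⟩ := exists_subset_card_eq hk
  let e : Fin k ≃ t := (t.equivFinOfCardEq htk).symm
  have he : ∀ i, (e i : V) ∈ s := fun i => hts (e i).2
  refine hG ⟨⟨⟨Sum.elim (fun _ => v) fun i => e i, ?_⟩, ?_⟩⟩
  · rintro (a | a) (b | b) h
    · exact congrArg _ (Subsingleton.elim a b)
    · exact absurd h (hs _ (he b)).ne
    · exact absurd h (hs _ (he a)).ne'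
    · exact congrArg _ (e.injective (Subtype.ext h))
  · change ∀ {a b}, G.Adj (Sum.elim (fun _ => v) (fun i => (e i : V)) a)
      (Sum.elim (fun _ => v) (fun i => (e i : V)) b) ↔ _
    rintro (a | a) (b | b)
    · simp
    · simpa using hs _ (he b)
    · simpa using (hs _ (he a)).symm
    · simpa using hind _ (he a) _ (he b)

theorem IsStarFree.card_filter_adj_le [DecidableRel G.Adj] (hG : G.IsStarFree k) {t : ℕ}
    {A : Finset V} {g : V → Fin t} (hg : ∀ u ∈ A, ∀ w ∈ A, G.Adj u w → g u ≠ g w) (v : V) :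
    #{u ∈ A | G.Adj v u} ≤ k * t := by
  have := card_le_mul_card_image_of_maps_to (f := g) (s := {u ∈ A | G.Adj v u}) (t := univ)
    (fun _ _ => mem_univ _) k fun j _ => (hG.card_lt v _ ?_ ?_).le
  · simpa using this
  · intro u hu
    simp only [mem_filter] at hu
    exact hu.1.2
  · intro u hu w hw huw
    simp only [mem_filter] at hu hw
    exact hg u hu.1.1 w hw.1.1 huw (hu.2.trans hw.2.symm)

theorem cfcnChromaticNumber_le_card {α : Type*} [Fintype α] {c : V → α}
    (hc : G.IsCFCNColoring c) : G.cfcnChromaticNumber ≤ Fintype.card α := by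
  let e := Fintype.equivFin α
  refine Nat.sInf_le ⟨fun v => e (c v), fun v => ?_⟩
  obtain ⟨a, u, hu, huniq⟩ := hc v
  exact ⟨e a, u, ⟨hu.1, congrArg e hu.2⟩, fun w hw => huniq w ⟨hw.1, e.injective hw.2⟩⟩

variable [Fintype V]

/-- A maximal `t`-colorable vertex set: every vertex outside it sees all `t` color classes. -/
theorem exists_maximal_colorable (G : SimpleGraph V) [DecidableRel G.Adj] {t : ℕ} (ht : 0 < t) :
    ∃ (A : Finset V) (g : V → Fin t), (∀ u ∈ A, ∀ w ∈ A, G.Adj u w → g u ≠ g w) ∧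
      ∀ v ∉ A, t ≤ #{u ∈ A | G.Adj v u} := by
  classical
  let P : Finset V → Prop :=
    fun A => ∃ g : V → Fin t, ∀ u ∈ A, ∀ w ∈ A, G.Adj u w → g u ≠ g w
  obtain ⟨A, ⟨g, hg⟩, hmax⟩ :=
    (Set.toFinite {A | P A}).exists_maximal ⟨∅, fun _ => ⟨0, ht⟩, by simp⟩
  refine ⟨A, g, hg, fun v hv => ?_⟩
  have hsurj : Set.SurjOn g ({u ∈ A | G.Adj v u} : Finset V) (univ : Finset (Fin t)) := by
    intro j _
    by_contra hj
    have hj : ∀ u ∈ A, G.Adj v u → g u ≠ j := fun u hu hvu huj =>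
      hj ⟨u, by simp [hu, hvu], huj⟩
    -- If `v` sees no vertex of color `j`, it can join `A` with color `j`, against maximality.
    refine hv (hmax (y := insert v A) ⟨Function.update g v j, ?_⟩ (subset_insert v A)
      (mem_insert_self v A))
    have hne : ∀ u ∈ A, u ≠ v := fun u hu => by rintro rfl; exact hv hu
    intro u hu w hw huw
    rcases mem_insert.1 hu with rfl | huA <;> rcases mem_insert.1 hw with rfl | hwA
    · exact absurd huw (G.loopless.irrefl _)
    · rw [Function.update_self, Function.update_of_ne (hne w hwA)]
      exact (hj w hwA huw).symm
    · rw [Function.update_self, Function.update_of_ne (hne u huA)]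
      exact hj u huA huw.symm
    · rw [Function.update_of_ne (hne u huA), Function.update_of_ne (hne w hwA)]
      exact hg u huA w hwA huw
  simpa using card_le_card_of_surjOn g hsurj

theorem IsStarFree.cfcnChromaticNumber_le [DecidableRel G.Adj] (hG : G.IsStarFree k)
    (hk : 0 < k) {L : ℕ} (hL : 0 < L) (hΔ : 4 * G.maxDegree ≤ 2 ^ L) :
    G.cfcnChromaticNumber ≤ 24 * k * L + 1 := by
  classical
  obtain ⟨A, g, hg, hout⟩ := G.exists_maximal_colorable (t := 2 * L) (by omega)
  have hle := hG.card_filter_adj_le hg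
  -- Degrees in `A` are at most `k * (2 * L)`: properness needs four times this, and `24 * (#E / 2)
  -- ≤ 12 * #E` needs twelve times. Traces have at least `2 * L` vertices, so their half-size is at
  -- least `L`.
  have hR : 24 * k * L = 12 * (k * (2 * L)) := by ring
  obtain ⟨f, hf⟩ := G.exists_isGoodOn (R := 24 * k * L) (D := G.maxDegree) Aᶜ
    (fun w => {u ∈ A | G.Adj w u}) A (by positivity)
    (fun v => by have := hle v; omega)
    (fun v => by
      refine (card_le_card fun w hw => ?_).trans (G.degree_le_maxDegree v)
      simp only [mem_filter] at hw
      simpa using hw.2.2.symm)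
    (fun w hw => card_pos.1 <| by have := hout w (mem_compl.1 hw); omega)
    (fun w _ => by have := hle w; omega)
    (fun w hw => hΔ.trans <| Nat.pow_le_pow_right two_pos <| by
      have := hout w (mem_compl.1 hw); omega)
  -- `none` is the one extra color; it is never needed as a unique color.
  let c : V → Option (Fin (24 * k * L)) := fun v => if v ∈ A then some (f v) else none
  have hc : ∀ {v b}, c v = some b → v ∈ A ∧ f v = b := fun {v b} h => by
    by_cases hv : v ∈ A
    · simpa [c, hv] using h
    · simp [c, hv] at h
  have hcol : G.IsCFCNColoring c := by
    intro v
    by_cases hv : v ∈ A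
    · refine ⟨some (f v), v, ⟨Set.mem_insert v _, by simp [c, hv]⟩, fun w hw => ?_⟩
      obtain ⟨hwA, hwf⟩ := hc hw.2
      refine (Set.mem_insert_iff.1 hw.1).resolve_right fun hvw => ?_
      exact hf.1 v hv w hwA hvw hwf.symm
    · obtain ⟨u, hu, huniq⟩ := hf.2 v (mem_compl.2 hv) (filter_subset _ _)
      obtain ⟨huA, hvu⟩ := mem_filter.1 hu
      refine ⟨some (f u), u, ⟨Set.mem_insert_of_mem v hvu, by simp [c, huA]⟩, fun w hw => ?_⟩
      obtain ⟨hwA, hwf⟩ := hc hw.2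
      refine huniq w (mem_filter.2 ⟨hwA, ?_⟩) hwf
      refine (Set.mem_insert_iff.1 hw.1).resolve_left ?_
      rintro rfl
      exact hv hwA
  simpa using cfcnChromaticNumber_le_card hcol

end StarFree

end SimpleGraph

/-! ### The logarithmic bound -/

theorem corollary3 :
    ∃ C : ℝ, 0 < C ∧
      ∀ (k : ℕ) (V : Type*) [Fintype V] (G : SimpleGraph V) [DecidableRel G.Adj],
        G.IsStarFree k → 2 ≤ G.maxDegree →
          (G.cfcnChromaticNumber : ℝ) ≤ C * (k : ℝ) ^ 2 * Real.log (G.maxDegree : ℝ) := by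
  have hlog2 : 0 < Real.log 2 := Real.log_pos one_lt_two
  refine ⟨100 / Real.log 2, by positivity, fun k V _ G _ hG hΔ => ?_⟩
  have hV : Nonempty V := by
    by_contra hV
    rw [not_nonempty_iff] at hV
    simp at hΔ
  -- `K_{1,0}` is a single vertex, which every nonempty graph contains.
  have hk : 0 < k := by simpa using hG.card_lt hV.some ∅ (by simp) (by simp)
  set Δ := G.maxDegree
  have hpow : 4 * Δ ≤ 2 ^ (Nat.log 2 Δ + 3) := by
    have := Nat.lt_pow_succ_log_self one_lt_two Δ
    rw [pow_add]
    rw [pow_succ] at this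
    omega
  have hle := hG.cfcnChromaticNumber_le hk (Nat.succ_pos _) hpow
  set L := Nat.log 2 Δ + 3 with hLdef
  -- The additive `3` in `L` is absorbed using `log 2 ≤ log Δ`; this `4` times the `25` below gives
  -- `100`.
  have hL : (L : ℝ) * Real.log 2 ≤ 4 * Real.log Δ := by
    have h1 : Real.log 2 ≤ Real.log Δ := Real.log_le_log two_pos (by exact_mod_cast hΔ)
    have h2 : (Nat.log 2 Δ : ℝ) * Real.log 2 ≤ Real.log Δ := by
      rw [← Real.log_pow]
      refine Real.log_le_log (by positivity) ?_
      exact_mod_cast Nat.pow_log_le_self 2 (by omega)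
    rw [hLdef]
    push_cast
    linarith
  have hkL : 24 * k * L + 1 ≤ 25 * k ^ 2 * L := by
    have h1 : 1 ≤ k * L := Nat.mul_pos hk (Nat.succ_pos _)
    have h2 : k * L ≤ k ^ 2 * L := Nat.mul_le_mul_right L (Nat.le_self_pow two_ne_zero k)
    nlinarith
  calc (G.cfcnChromaticNumber : ℝ) ≤ 25 * (k : ℝ) ^ 2 * L := by exact_mod_cast hle.trans hkL
    _ = 25 * (k : ℝ) ^ 2 * (L * Real.log 2) / Real.log 2 := by field_simp
    _ ≤ 25 * (k : ℝ) ^ 2 * (4 * Real.log Δ) / Real.log 2 := by gcongr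
    _ = 100 / Real.log 2 * (k : ℝ) ^ 2 * Real.log Δ := by ring
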